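/- Consider a finite network of queues $i\in I$. A fraction $r(j,i)\ge 0$ of the vehicles leaving queue $j$ travels to queue $i$, which takes time $\tau(j,i)>0$; $\sum_i r(j,i)\le 1$, and every vehicle eventually leaves the network, i.e. $R^n\to 0$ for $R=(r(i,j))$. Let $\bar\tau=\max_{j,i}\tau(j,i)$. The external arrival rates $e(i)(t)\ge 0$ and saturation flows $c(i)(t)\ge 0$, $t\ge 0$, are locally integrable. A trajectory consists of queue lengths $x(i)(t)$, $t\ge 0$, and locally integrable departure rates $b(i)(t)$, $t\ge-\bar\tau$, such that for all $i$ and $t\ge 0$ $$x(i)(t)=x(i)(0)+\int_0^t\Big[e(i)(s)+\sum_j b(j)(s-\tau(j,i))\,r(j,i)-b(i)(s)\Big]ds,$$ and for almost every $t\ge 0$: $b(i)(t)=c(i)(t)$ if $x(i)(t)>0$, $b(i)(t)\in[0,c(i)(t)]$ if $x(i)(t)=0$, and $b(i)(t)=0$ if $x(i)(t)<0$. Its initial state $(x(0),\beta(0))$ consists of the queue lengths $x(i)(0)\ge 0$ and the history $\beta(0)=b|_{[-\bar\tau,0]}\ge 0$. Let $T>0$. Suppose that $e$ and $c$ have period $T$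 and that the stability condition holds: for some $\epsilon>0$, componentwise, $\bar c>[I-R^T]^{-1}\bar e+\epsilon\mathbf 1$, where $\bar e=\frac1T\int_0^T e(t)\,dt$, $\bar c=\frac1T\int_0^T c(t)\,dt$, and $R^T$ is the transpose of $R$. Alternatively, suppose, without periodicity, that for some $\epsilon>0$, componentwise, $\int_0^{NT}c(t)\,dt>[I-R^T]^{-1}\int_0^{NT}e(t)\,dt+\epsilon NT\,\mathbf 1$ for all integers $N\ge 1$. Let $(x,b)$ be a trajectory starting from any initial state $(x(0),\beta(0))$, and let $(z,b')$ be a trajectory starting from the zero state $(0,0)$. Then the two trajectories converge: for every $i$, as $t\to\infty$, $$|x(i)(t)-z(i)(t)|\to 0\quad\text{and}\quad \sup_{s\in[t-\bar\tau,\,t]}\Big|\int_{t-\bar\tau}^s[b(i)(r)-b'(i)(r)]\,dr\Big|\to 0 .$$ -/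

import Mathlib

open MeasureTheory Set Filter Topology
open scoped Matrix ENNReal

/-- A fluid network of queues, indexed by a finite set `ι`, with routing ratios `r j i`, travel
times `τ j i`, external arrival rates `e i t` and saturation flows (service rates) `c i t`.
Only the values of `e` and `c` at times `t ≥ 0` matter. -/
structure QueueNetwork (ι : Type*) [Fintype ι] [DecidableEq ι] where
  /-- `r j i` is the fraction of the vehicles leaving queue `j` that is routed to queue `i`. -/
  r : Matrix ι ι ℝ
  /-- `τ j i` is the travel time from queue `j` to queue `i`. -/
  τ : ι → ι → ℝ
  /-- `e i t` is the external arrival rate at queue `i` at time `t`. -/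
  e : ι → ℝ → ℝ
  /-- `c i t` is the saturation flow of queue `i` at time `t`. -/
  c : ι → ℝ → ℝ
  r_nonneg : ∀ j i, 0 ≤ r j i
  r_sum_le_one : ∀ j, ∑ i, r j i ≤ 1
  /-- Every vehicle eventually leaves: `(r ^ n) j i` is the fraction of the vehicles leaving
  queue `j` whose `n`-th next queue is `i`. -/
  r_pow_tendsto : ∀ j i, Tendsto (fun n : ℕ => (r ^ n) j i) atTop (𝓝 0)
  τ_pos : ∀ j i, 0 < τ j i
  e_nonneg : ∀ i t, 0 ≤ t → 0 ≤ e i t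
  c_nonneg : ∀ i t, 0 ≤ t → 0 ≤ c i t
  e_integrable : ∀ i t, 0 ≤ t → IntervalIntegrable (e i) volume 0 t
  c_integrable : ∀ i t, 0 ≤ t → IntervalIntegrable (c i) volume 0 t

namespace QueueNetwork

variable {ι : Type*} [Fintype ι] [DecidableEq ι]

/-- The largest travel time, i.e. the length of the history window. -/
noncomputable def maxDelay (N : QueueNetwork ι) : ℝ := ⨆ p : ι × ι, N.τ p.1 p.2

/-- The total arrival rate at queue `i`, given the departure rates `b`. -/
noncomputable def inflow (N : QueueNetwork ι) (b : ι → ℝ → ℝ) (i : ι) (t : ℝ) : ℝ :=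
  N.e i t + ∑ j, b j (t - N.τ j i) * N.r j i

/-- The queue lengths `x i t`, `t ≥ 0`, and departure rates `b i t`, `t ≥ -maxDelay`, solve the
queueing equations. The differential equation `x' = a - b` is in integrated form, and the rule for
the rates `b` holds at almost every time `t ≥ 0`. -/
structure IsSolution (N : QueueNetwork ι) (x b : ι → ℝ → ℝ) : Prop where
  integrable : ∀ i t, 0 ≤ t → IntervalIntegrable (b i) volume (-N.maxDelay) t
  balance : ∀ i t, 0 ≤ t → x i t = x i 0 + ∫ s in (0 : ℝ)..t, (N.inflow b i s - b i s)
  service : ∀ i, ∀ᵐ t : ℝ, 0 ≤ t →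
    (0 < x i t → b i t = N.c i t) ∧
    (x i t = 0 → b i t ∈ Icc 0 (N.c i t)) ∧
    (x i t < 0 → b i t = 0)

/-- `(x, b)` is the trajectory starting in the state `(x₀, β₀)`: the vector `x₀ ≥ 0` of initial
queue lengths and the history `β₀ ≥ 0` of departure rates over the window `[-maxDelay, 0]`. -/
structure IsTrajectory (N : QueueNetwork ι) (x₀ : ι → ℝ) (β₀ : ι → ℝ → ℝ)
    (x b : ι → ℝ → ℝ) : Prop where
  x₀_nonneg : ∀ i, 0 ≤ x₀ i
  β₀_nonneg : ∀ i, ∀ s ∈ Icc (-N.maxDelay) 0, 0 ≤ β₀ i s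
  initial_queue : ∀ i, x i 0 = x₀ i
  initial_history : ∀ i, ∀ s ∈ Icc (-N.maxDelay) 0, b i s = β₀ i s
  solution : N.IsSolution x b

/-- The external arrivals and the saturation flows have period `T`. -/
def IsPeriodic (N : QueueNetwork ι) (T : ℝ) : Prop :=
  ∀ i t, 0 ≤ t → N.e i (t + T) = N.e i t ∧ N.c i (t + T) = N.c i t

/-- The average over `[0, T]` of each component of `f`. -/
noncomputable def average (T : ℝ) (f : ι → ℝ → ℝ) : ι → ℝ :=
  fun i => (1 / T) * ∫ t in (0 : ℝ)..T, f i t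

/-- The stability condition for period `T`: `c̄ > (I - Rᵀ)⁻¹ ē + ε 1` for some `ε > 0`. -/
def Stable (N : QueueNetwork ι) (T : ℝ) : Prop :=
  ∃ ε > 0, ∀ i, average T N.c i > ((1 - N.rᵀ)⁻¹ *ᵥ average T N.e) i + ε

/-- The form of the stability condition for arrivals and saturation flows that need not be
periodic. -/
def LongRunStable (N : QueueNetwork ι) (T : ℝ) : Prop :=
  ∃ ε > 0, ∀ n : ℕ, 1 ≤ n → ∀ i,
    ∫ t in (0 : ℝ)..(n * T), N.c i t >
      ((1 - N.rᵀ)⁻¹ *ᵥ fun j => ∫ t in (0 : ℝ)..(n * T), N.e j t) i + ε * n * T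

end QueueNetwork

/-! ### Nonnegative matrices with vanishing powers -/

section Matrix

variable {ι : Type*} [Fintype ι] [DecidableEq ι]

/-! The network is monotone, and zero is the smallest initial state, so `z ≤ x` and `b' ≤ b` almost
everywhere (`departure_mono`, `queue_mono`). Hence the cumulative surplus `B = ∫ (b - b')` is
nondecreasing. External arrivals cancel in the balance of the difference, and `x - z ≥ 0` turns it
into `B ≤ const + Rᵀ B`; applying `(I - Rᵀ)⁻¹` bounds `B` (`cumulative_departure_le`), so `B`
converges.

Its increments over the history window then vanish, which is the claim on departures, and by the
balance equation each `x i - z i` has a limit `L ≥ 0`. If `L > 0`, queue `i` would eventually stay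
positive and discharge at the full rate `c i`, more than the traffic equations allow under stability
(`LongRunStable.not_eventually_pos`). So `L = 0`. -/

theorem tendsto_pow_mulVec_zero {P : Matrix ι ι ℝ}
    (hP : ∀ i j, Tendsto (fun n : ℕ => (P ^ n) i j) atTop (𝓝 0)) (v : ι → ℝ) (i : ι) :
    Tendsto (fun n : ℕ => ((P ^ n) *ᵥ v) i) atTop (𝓝 0) := by
  have : Tendsto (fun n : ℕ => ∑ j, (P ^ n) i j * v j) atTop (𝓝 (∑ j, 0 * v j)) :=
    tendsto_finsetSum _ fun j _ => (hP i j).mul_const _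
  simpa [Matrix.mulVec, dotProduct] using this

/-- A kernel vector of `1 - P` is fixed by every `P ^ n`, hence equals the limit `0`. -/
theorem isUnit_one_sub_of_tendsto_pow_zero {P : Matrix ι ι ℝ}
    (hP : ∀ i j, Tendsto (fun n : ℕ => (P ^ n) i j) atTop (𝓝 0)) : IsUnit (1 - P) := by
  rw [← Matrix.mulVec_injective_iff_isUnit]
  refine (injective_iff_map_eq_zero (Matrix.mulVecLin (1 - P))).2 fun v hv => ?_
  have hfix : P *ᵥ v = v := by
    have h : v - P *ᵥ v = 0 := by simpa [Matrix.sub_mulVec] using hv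
    exact (sub_eq_zero.1 h).symm
  have hpow : ∀ n : ℕ, (P ^ n) *ᵥ v = v := by
    intro n
    induction n with
    | zero => simp
    | succ n ih => rw [pow_succ, ← Matrix.mulVec_mulVec, hfix, ih]
  funext i
  have h := tendsto_pow_mulVec_zero hP v i
  simp only [hpow] at h
  exact tendsto_nhds_unique tendsto_const_nhds h

/-- Nonnegative entries let the inequality be iterated to `v ≤ P ^ n v`, which tends to `0`. -/
theorem nonpos_of_le_mulVec {P : Matrix ι ι ℝ} (hP₀ : ∀ i j, 0 ≤ P i j)
    (hP : ∀ i j, Tendsto (fun n : ℕ => (P ^ n) i j) atTop (𝓝 0)) {v : ι → ℝ}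
    (hv : ∀ i, v i ≤ (P *ᵥ v) i) (i : ι) : v i ≤ 0 := by
  have hpow : ∀ (n : ℕ) (i : ι), v i ≤ ((P ^ n) *ᵥ v) i := by
    intro n
    induction n with
    | zero => simp
    | succ n ih =>
      intro i
      rw [pow_succ', ← Matrix.mulVec_mulVec]
      refine (hv i).trans ?_
      exact Finset.sum_le_sum fun j _ => mul_le_mul_of_nonneg_left (ih j) (hP₀ i j)
  exact ge_of_tendsto' (tendsto_pow_mulVec_zero hP v i) fun n => hpow n i

/-- With `w = (1 - P)⁻¹ u`, so that `w = u + P w`, the difference satisfies `v - w ≤ P (v - w)`. -/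
theorem le_inv_one_sub_mulVec {P : Matrix ι ι ℝ} (hP₀ : ∀ i j, 0 ≤ P i j)
    (hP : ∀ i j, Tendsto (fun n : ℕ => (P ^ n) i j) atTop (𝓝 0)) {u v : ι → ℝ}
    (hv : ∀ i, v i ≤ u i + (P *ᵥ v) i) (i : ι) : v i ≤ ((1 - P)⁻¹ *ᵥ u) i := by
  have hdet := (Matrix.isUnit_iff_isUnit_det _).1 (isUnit_one_sub_of_tendsto_pow_zero hP)
  have hw : (1 - P) *ᵥ ((1 - P)⁻¹ *ᵥ u) = u := by
    rw [Matrix.mulVec_mulVec, Matrix.mul_nonsing_inv _ hdet, Matrix.one_mulVec]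
  set w := (1 - P)⁻¹ *ᵥ u
  have hsub : ∀ i, w i - (P *ᵥ w) i = u i := fun i => by
    simpa [Matrix.sub_mulVec] using congrFun hw i
  have := nonpos_of_le_mulVec hP₀ hP (v := v - w) (fun i => by
    rw [Matrix.mulVec_sub]
    have h₁ := hv i
    have h₂ := hsub i
    simp only [Pi.sub_apply]
    linarith) i
  simpa using this

end Matrix

/-! ### Sign and zeros of primitives -/

section Integral

theorem continuousOn_of_eq_add_integral {f g : ℝ → ℝ} {S : ℝ}
    (hg : IntervalIntegrable g volume 0 S)
    (hf : ∀ t ∈ Icc 0 S, f t = f 0 + ∫ s in (0 : ℝ)..t, g s) : ContinuousOn f (Icc 0 S) := by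
  rcases lt_or_ge S 0 with hS | hS
  · simp [Icc_eq_empty (not_le.2 hS)]
  refine ContinuousOn.congr (f := fun t => f 0 + ∫ s in (0 : ℝ)..t, g s) ?_ hf
  have := intervalIntegral.continuousOn_primitive_interval' hg left_mem_uIcc
  rw [uIcc_of_le hS] at this
  exact continuousOn_const.add this

/-- A primitive starting at a nonnegative value, whose rate is nonnegative wherever the primitive
is negative, stays nonnegative. -/
theorem nonneg_of_rate_nonneg_on_neg {f g : ℝ → ℝ} {S : ℝ}
    (hg : IntervalIntegrable g volume 0 S)
    (hf : ∀ t ∈ Icc 0 S, f t = f 0 + ∫ s in (0 : ℝ)..t, g s) (hf₀ : 0 ≤ f 0)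
    (hneg : ∀ᵐ t : ℝ, t ∈ Icc 0 S → f t < 0 → 0 ≤ g t) : ∀ t ∈ Icc 0 S, 0 ≤ f t := by
  intro t ht
  by_contra! hlt
  have hcont : ContinuousOn f (Icc 0 t) :=
    (continuousOn_of_eq_add_integral hg hf).mono (Icc_subset_Icc_right ht.2)
  -- `sSup A` is the last time before `t` at which `f` is nonnegative; after it `f` is negative, so
  -- `f` cannot decrease.
  set A : Set ℝ := Icc 0 t ∩ f ⁻¹' Ici 0 with hA
  have hAclosed : IsClosed A := hcont.preimage_isClosed_of_isClosed isClosed_Icc isClosed_Ici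
  have hAbdd : BddAbove A := ⟨t, fun s hs => hs.1.2⟩
  have hσ : sSup A ∈ A := hAclosed.csSup_mem ⟨0, ⟨le_rfl, ht.1⟩, hf₀⟩ hAbdd
  set σ := sSup A
  have hσS : σ ∈ Icc 0 S := ⟨hσ.1.1, hσ.1.2.trans ht.2⟩
  have hlast : ∀ s ∈ Ioc σ t, f s < 0 := by
    intro s hs
    by_contra! h
    exact absurd (le_csSup hAbdd ⟨⟨hσ.1.1.trans hs.1.le, hs.2⟩, h⟩) (not_le.2 hs.1)
  have hsub : ∀ s ∈ Icc 0 S, IntervalIntegrable g volume 0 s := fun s hs =>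
    hg.mono_set (by
      rw [uIcc_of_le hs.1, uIcc_of_le (hs.1.trans hs.2)]; exact Icc_subset_Icc_right hs.2)
  have hdiff : f t - f σ = ∫ s in σ..t, g s := by
    rw [hf t ht, hf σ hσS, ← intervalIntegral.integral_interval_sub_left (hsub t ht) (hsub σ hσS)]
    ring
  have hint : 0 ≤ ∫ s in σ..t, g s := by
    rw [intervalIntegral.integral_of_le hσ.1.2]
    refine setIntegral_nonneg_of_ae_restrict ?_
    refine (ae_restrict_iff' measurableSet_Ioc).2 ?_
    filter_upwards [hneg] with s hs hsI
    exact hs ⟨hσ.1.1.trans hsI.1.le, hsI.2.trans ht.2⟩ (hlast s hsI)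
  have : 0 ≤ f σ := hσ.2
  linarith

/-- The rate of a nonnegative primitive vanishes at almost every zero of the primitive. -/
theorem ae_rate_eq_zero_of_nonneg {f g : ℝ → ℝ} {S : ℝ}
    (hg : IntervalIntegrable g volume 0 S)
    (hf : ∀ t ∈ Icc 0 S, f t = f 0 + ∫ s in (0 : ℝ)..t, g s) (hf₀ : ∀ t ∈ Icc 0 S, 0 ≤ f t) :
    ∀ᵐ t : ℝ, t ∈ Icc 0 S → f t = 0 → g t = 0 := by
  -- Dropping the two endpoints makes a zero of `f` an interior minimum, where the derivative `g t`
  -- must vanish.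
  filter_upwards [hg.ae_hasDerivAt_integral, Measure.ae_ne volume 0, Measure.ae_ne volume S]
    with t hderiv h₀ hS ht hft
  have ht' : t ∈ Ioo 0 S := ⟨lt_of_le_of_ne ht.1 (Ne.symm h₀), lt_of_le_of_ne ht.2 hS⟩
  have hnhds : Icc 0 S ∈ 𝓝 t := Icc_mem_nhds ht'.1 ht'.2
  have hSpos : (0 : ℝ) ≤ S := ht.1.trans ht.2
  have hd := hderiv (by rwa [uIcc_of_le hSpos]) 0 left_mem_uIcc
  have hdf : HasDerivAt f (g t) t := by
    refine (hd.const_add (f 0)).congr_of_eventuallyEq ?_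
    filter_upwards [hnhds] with s hs using hf s hs
  have hmin : IsLocalMin f t := by
    filter_upwards [hnhds] with s hs
    rw [hft]
    exact hf₀ s hs
  exact hmin.hasDerivAt_eq_zero hdf

end Integral

/-! ### Basic properties of solutions -/

namespace QueueNetwork

variable {ι : Type*} [Fintype ι] [DecidableEq ι] {N : QueueNetwork ι}

theorem τ_le_maxDelay (N : QueueNetwork ι) (j i : ι) : N.τ j i ≤ N.maxDelay :=
  le_ciSup (f := fun p : ι × ι => N.τ p.1 p.2) (finite_range _).bddAbove (j, i)

theorem maxDelay_nonneg (N : QueueNetwork ι) : 0 ≤ N.maxDelay :=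
  Real.iSup_nonneg fun p => (N.τ_pos p.1 p.2).le

/-- The time step for induction: departures up to `S` determine the delayed arrivals up to `S + δ`.
-/
theorem exists_pos_le_τ (N : QueueNetwork ι) : ∃ δ > 0, ∀ j i, δ ≤ N.τ j i := by
  rcases isEmpty_or_nonempty ι with h | h
  · exact ⟨1, one_pos, fun j => (h.false j).elim⟩
  · obtain ⟨p, hp⟩ := Finite.exists_min fun p : ι × ι => N.τ p.1 p.2
    exact ⟨N.τ p.1 p.2, N.τ_pos _ _, fun j i => hp (j, i)⟩

theorem transpose_pow_tendsto (N : QueueNetwork ι) (i j : ι) :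
    Tendsto (fun n : ℕ => (N.rᵀ ^ n) i j) atTop (𝓝 0) := by
  simpa only [← Matrix.transpose_pow, Matrix.transpose_apply] using N.r_pow_tendsto j i

theorem le_inv_one_sub_transpose_mulVec (N : QueueNetwork ι) {u v : ι → ℝ}
    (hv : ∀ i, v i ≤ u i + ∑ j, N.r j i * v j) (i : ι) :
    v i ≤ ((1 - N.rᵀ)⁻¹ *ᵥ u) i :=
  le_inv_one_sub_mulVec (fun i j => N.r_nonneg j i) N.transpose_pow_tendsto hv i

theorem ae_comp_sub {p : ℝ → Prop} (h : ∀ᵐ t : ℝ, p t) (d : ℝ) : ∀ᵐ t : ℝ, p (t - d) :=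
  (measurePreserving_sub_right volume d).quasiMeasurePreserving.ae h

namespace IsSolution

variable {x b z b' : ι → ℝ → ℝ}

theorem intervalIntegrable (h : N.IsSolution x b) (i : ι) {s t : ℝ} (hs : -N.maxDelay ≤ s)
    (ht : -N.maxDelay ≤ t) : IntervalIntegrable (b i) volume s t := by
  have aux : ∀ u, -N.maxDelay ≤ u → IntervalIntegrable (b i) volume (-N.maxDelay) u := by
    intro u hu
    refine (h.integrable i (max u 0) (le_max_right _ _)).mono_set ?_
    rw [uIcc_of_le hu, uIcc_of_le (hu.trans (le_max_left _ _))]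
    exact Icc_subset_Icc_right (le_max_left _ _)
  exact (aux s hs).symm.trans (aux t ht)

theorem intervalIntegrable_delayed (h : N.IsSolution x b) (j i : ι) {t : ℝ} (ht : 0 ≤ t) :
    IntervalIntegrable (fun s => b j (s - N.τ j i) * N.r j i) volume 0 t := by
  have hτ := N.τ_le_maxDelay j i
  have := (h.intervalIntegrable j (s := 0 - N.τ j i) (t := t - N.τ j i)
    (by linarith) (by linarith)).comp_sub_right (N.τ j i)
  simp only [sub_add_cancel] at this
  exact this.mul_const _

theorem intervalIntegrable_inflow (h : N.IsSolution x b) (i : ι) {t : ℝ} (ht : 0 ≤ t) :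
    IntervalIntegrable (N.inflow b i) volume 0 t := by
  have : N.inflow b i = N.e i + ∑ j, fun s => b j (s - N.τ j i) * N.r j i := by
    funext s
    simp [inflow]
  rw [this]
  exact (N.e_integrable i t ht).add
    (IntervalIntegrable.sum _ fun j _ => h.intervalIntegrable_delayed j i ht)

theorem intervalIntegrable_rate (h : N.IsSolution x b) (i : ι) {t : ℝ} (ht : 0 ≤ t) :
    IntervalIntegrable (fun s => N.inflow b i s - b i s) volume 0 t :=
  (h.intervalIntegrable_inflow i ht).sub <| h.intervalIntegrable i
    (neg_nonpos.2 N.maxDelay_nonneg) ((neg_nonpos.2 N.maxDelay_nonneg).trans ht)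

/-- Conservation of vehicles in terms of cumulative departures. -/
theorem queue_eq (h : N.IsSolution x b) (i : ι) {t : ℝ} (ht : 0 ≤ t) :
    x i t = x i 0 + ((∫ s in (0 : ℝ)..t, N.e i s)
      + ∑ j, N.r j i * ∫ s in (-N.τ j i)..(t - N.τ j i), b j s) - ∫ s in (0 : ℝ)..t, b i s := by
  have hm := N.maxDelay_nonneg
  rw [h.balance i t ht, intervalIntegral.integral_sub (h.intervalIntegrable_inflow i ht)
    (h.intervalIntegrable i (by linarith) (by linarith))]
  have : ∫ s in (0 : ℝ)..t, N.inflow b i s = (∫ s in (0 : ℝ)..t, N.e i s)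
      + ∑ j, N.r j i * ∫ s in (-N.τ j i)..(t - N.τ j i), b j s := by
    simp only [inflow]
    have hsum : IntervalIntegrable (fun s => ∑ j, b j (s - N.τ j i) * N.r j i) volume 0 t := by
      simpa only [Finset.sum_fn] using
        IntervalIntegrable.sum Finset.univ fun j _ => h.intervalIntegrable_delayed j i ht
    rw [intervalIntegral.integral_add (N.e_integrable i t ht) hsum,
      intervalIntegral.integral_finsetSum fun j _ => h.intervalIntegrable_delayed j i ht]
    congr 1
    refine Finset.sum_congr rfl fun j _ => ?_
    rw [intervalIntegral.integral_mul_const, mul_comm,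
      intervalIntegral.integral_comp_sub_right (b j), zero_sub]
  rw [this]
  ring

theorem departure_nonneg (h : N.IsSolution x b) (i : ι) : ∀ᵐ t : ℝ, 0 ≤ t → 0 ≤ b i t := by
  filter_upwards [h.service i] with t ht h₀
  obtain ⟨hpos, hzero, hneg⟩ := ht h₀
  rcases lt_trichotomy (x i t) 0 with hx | hx | hx
  · exact (hneg hx).ge
  · exact (hzero hx).1
  · exact (N.c_nonneg i t h₀).trans_eq (hpos hx).symm

theorem departure_le (h : N.IsSolution x b) (i : ι) : ∀ᵐ t : ℝ, 0 ≤ t → b i t ≤ N.c i t := by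
  filter_upwards [h.service i] with t ht h₀
  obtain ⟨hpos, hzero, hneg⟩ := ht h₀
  rcases lt_trichotomy (x i t) 0 with hx | hx | hx
  · exact (hneg hx).trans_le (N.c_nonneg i t h₀)
  · exact (hzero hx).2
  · exact (hpos hx).le

end IsSolution

/-- Larger departure rates up to time `S` give larger inflows up to time `S + δ`. -/
theorem inflow_mono {f g : ι → ℝ → ℝ} {S δ : ℝ} (hδ : ∀ j i, δ ≤ N.τ j i)
    (hfg : ∀ j, ∀ᵐ t : ℝ, t ∈ Icc (-N.maxDelay) S → f j t ≤ g j t) (i : ι) :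
    ∀ᵐ t : ℝ, t ∈ Icc 0 (S + δ) → N.inflow f i t ≤ N.inflow g i t := by
  filter_upwards [ae_all_iff.2 fun j => ae_comp_sub (hfg j) (N.τ j i)] with t ht htS
  refine add_le_add le_rfl (Finset.sum_le_sum fun j _ => ?_)
  refine mul_le_mul_of_nonneg_right (ht j ⟨?_, ?_⟩) (N.r_nonneg j i)
  · linarith [htS.1, N.τ_le_maxDelay j i]
  · linarith [htS.2, hδ j i]

/-- A negative queue would have no departures and a nonnegative inflow, so it could not have fallen
below zero. -/
theorem IsSolution.queue_nonneg {x b : ι → ℝ → ℝ} (h : N.IsSolution x b)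
    (hx₀ : ∀ i, 0 ≤ x i 0) (hb : ∀ i, ∀ᵐ t : ℝ, -N.maxDelay ≤ t → 0 ≤ b i t)
    (i : ι) {t : ℝ} (ht : 0 ≤ t) : 0 ≤ x i t := by
  have hinflow : ∀ᵐ s : ℝ, 0 ≤ s → 0 ≤ N.inflow b i s := by
    filter_upwards [ae_all_iff.2 fun j => ae_comp_sub (hb j) (N.τ j i)] with s hs h₀
    refine add_nonneg (N.e_nonneg i s h₀) (Finset.sum_nonneg fun j _ => ?_)
    exact mul_nonneg (hs j (by linarith [N.τ_le_maxDelay j i])) (N.r_nonneg j i)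
  refine nonneg_of_rate_nonneg_on_neg (h.intervalIntegrable_rate i ht)
    (fun s hs => h.balance i s hs.1) (hx₀ i) ?_ t ⟨ht, le_rfl⟩
  filter_upwards [hinflow, h.service i] with s hs hserv hsI hneg
  rw [(hserv hsI.1).2.2 hneg, sub_zero]
  exact hs hsI.1

/-! ### Monotonicity in the initial state -/

section Comparison

variable {x b z b' : ι → ℝ → ℝ}

theorem sub_queue_eq (hx : N.IsSolution x b) (hz : N.IsSolution z b') (i : ι) {t : ℝ}
    (ht : 0 ≤ t) : x i t - z i t = (x i 0 - z i 0)
      + ∫ s in (0 : ℝ)..t, ((N.inflow b i s - b i s) - (N.inflow b' i s - b' i s)) := by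
  rw [intervalIntegral.integral_sub (hx.intervalIntegrable_rate i ht)
    (hz.intervalIntegrable_rate i ht), hx.balance i t ht, hz.balance i t ht]
  ring

/-- Comparison for one queue: with a larger initial queue and a larger inflow, the queue stays
larger. -/
theorem queue_le_of_inflow_le (hx : N.IsSolution x b) (hz : N.IsSolution z b') {i : ι}
    (hx₀ : ∀ t, 0 ≤ t → 0 ≤ x i t) {S : ℝ} (hS : 0 ≤ S) (h₀ : z i 0 ≤ x i 0)
    (hin : ∀ᵐ t : ℝ, t ∈ Icc 0 S → N.inflow b' i t ≤ N.inflow b i t) :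
    ∀ t ∈ Icc 0 S, z i t ≤ x i t := by
  intro t ht
  refine sub_nonneg.1 (nonneg_of_rate_nonneg_on_neg (f := fun t => x i t - z i t)
    ((hx.intervalIntegrable_rate i hS).sub (hz.intervalIntegrable_rate i hS))
    (fun s hs => sub_queue_eq hx hz i hs.1) (sub_nonneg.2 h₀) ?_ t ht)
  filter_upwards [hin, hz.service i, hx.departure_le i] with s hs hserv hle hsI hneg
  -- Where `x < z`, the queue `z` is positive and is served at the full rate `c ≥ b`, so `x - z` has
  -- nonnegative rate.
  have hzpos : 0 < z i s := by linarith [hx₀ s hsI.1]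
  have h₁ := (hserv hsI.1).1 hzpos
  have h₂ := hle hsI.1
  have h₃ := hs hsI
  linarith

/-- Comparison for one queue: with a larger initial queue and a larger inflow, the departure rate
stays larger. -/
theorem departure_le_of_inflow_le (hx : N.IsSolution x b) (hz : N.IsSolution z b') {i : ι}
    (hx₀ : ∀ t, 0 ≤ t → 0 ≤ x i t) (hz₀ : ∀ t, 0 ≤ t → 0 ≤ z i t)
    {S : ℝ} (hS : 0 ≤ S) (h₀ : z i 0 ≤ x i 0)
    (hin : ∀ᵐ t : ℝ, t ∈ Icc 0 S → N.inflow b' i t ≤ N.inflow b i t) :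
    ∀ᵐ t : ℝ, t ∈ Icc 0 S → b' i t ≤ b i t := by
  have hle := queue_le_of_inflow_le hx hz hx₀ hS h₀ hin
  filter_upwards [hin, hx.service i, hz.departure_le i,
    ae_rate_eq_zero_of_nonneg (f := fun t => x i t - z i t)
      ((hx.intervalIntegrable_rate i hS).sub (hz.intervalIntegrable_rate i hS))
      (fun s hs => sub_queue_eq hx hz i hs.1) fun t ht => sub_nonneg.2 (hle t ht)]
    with t hin hserv hbc hrate ht
  -- If `x = 0` then `z = 0` too, and the rate of `x - z` vanishes there, so `b - b'` equals the
  -- inflow difference. If `x > 0` then `b = c ≥ b'`.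
  rcases (hx₀ t ht.1).eq_or_lt with hxt | hxt
  · have hzt : z i t = 0 := le_antisymm (hxt ▸ hle t ht) (hz₀ t ht.1)
    have h₁ := hrate ht (by rw [← hxt, hzt, sub_zero])
    have h₂ := hin ht
    linarith
  · exact (hbc ht.1).trans_eq ((hserv ht.1).1 hxt).symm

/-- Monotonicity of the network: a larger initial state gives larger departure rates. -/
theorem departure_mono (hx : N.IsSolution x b) (hz : N.IsSolution z b')
    (hx₀ : ∀ i t, 0 ≤ t → 0 ≤ x i t) (hz₀ : ∀ i t, 0 ≤ t → 0 ≤ z i t)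
    (h₀ : ∀ i, z i 0 ≤ x i 0)
    (hhist : ∀ i, ∀ᵐ t : ℝ, t ∈ Icc (-N.maxDelay) 0 → b' i t ≤ b i t) (i : ι) :
    ∀ᵐ t : ℝ, -N.maxDelay ≤ t → b' i t ≤ b i t := by
  obtain ⟨δ, hδ, hδτ⟩ := N.exists_pos_le_τ
  -- Method of steps: departures ordered up to `n * δ` order the inflows up to `(n + 1) * δ`, and
  -- each queue is then compared alone.
  have hstep : ∀ (n : ℕ) (i : ι),
      ∀ᵐ t : ℝ, t ∈ Icc (-N.maxDelay) (n * δ) → b' i t ≤ b i t := by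
    intro n
    induction n with
    | zero => simpa using hhist
    | succ n ih =>
      intro i
      filter_upwards [hhist i, departure_le_of_inflow_le hx hz (hx₀ i) (hz₀ i)
        (by positivity) (h₀ i) (inflow_mono hδτ ih i)] with t h₁ h₂ ht
      rcases le_total t 0 with hneg | hpos
      · exact h₁ ⟨ht.1, hneg⟩
      · exact h₂ ⟨hpos, ht.2.trans_eq (by push_cast; ring)⟩
  filter_upwards [ae_all_iff.2 fun n => hstep n i] with t ht hlow
  obtain ⟨n, hn⟩ := exists_nat_ge (t / δ)
  exact ht n ⟨hlow, (div_le_iff₀ hδ).1 hn⟩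

theorem queue_mono (hx : N.IsSolution x b) (hz : N.IsSolution z b')
    (hx₀ : ∀ i t, 0 ≤ t → 0 ≤ x i t) (h₀ : ∀ i, z i 0 ≤ x i 0)
    (hb : ∀ i, ∀ᵐ t : ℝ, -N.maxDelay ≤ t → b' i t ≤ b i t) (i : ι) {t : ℝ} (ht : 0 ≤ t) :
    z i t ≤ x i t := by
  refine queue_le_of_inflow_le hx hz (hx₀ i) ht (h₀ i) ?_ t ⟨ht, le_rfl⟩
  have := inflow_mono (N := N) (δ := 0) (S := t) (fun j i => (N.τ_pos j i).le)
    (fun j => by filter_upwards [hb j] with s hs hsI using hs hsI.1) i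
  simpa using this

end Comparison

end QueueNetwork

/-! ### Stability over long horizons -/

section Integral

theorem intervalIntegral_nonneg_of_ae_of_le {f : ℝ → ℝ} {a s t : ℝ}
    (hf : ∀ᵐ u : ℝ, a ≤ u → 0 ≤ f u) (has : a ≤ s) (hst : s ≤ t) : 0 ≤ ∫ u in s..t, f u := by
  refine intervalIntegral.integral_nonneg_of_ae_restrict hst ?_
  refine (ae_restrict_iff' measurableSet_Icc).2 ?_
  filter_upwards [hf] with u hu hI using hu (has.trans hI.1)

theorem integral_mul_period {f : ℝ → ℝ} {T : ℝ} (hT : 0 ≤ T)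
    (hf : ∀ t, 0 ≤ t → IntervalIntegrable f volume 0 t) (hper : ∀ t, 0 ≤ t → f (t + T) = f t)
    (n : ℕ) : ∫ t in (0 : ℝ)..(n * T), f t = n * ∫ t in (0 : ℝ)..T, f t := by
  have hshift : ∀ (n : ℕ) (t : ℝ), 0 ≤ t → f (t + n * T) = f t := by
    intro n
    induction n with
    | zero => simp
    | succ n ih =>
      intro t ht
      rw [show t + ((n + 1 : ℕ) : ℝ) * T = (t + n * T) + T by push_cast; ring,
        hper _ (by positivity), ih t ht]
  induction n with
  | zero => simp
  | succ n ih =>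
    have hn : (0 : ℝ) ≤ n * T := by positivity
    have hn' : (0 : ℝ) ≤ ((n + 1 : ℕ) : ℝ) * T := by positivity
    rw [← intervalIntegral.integral_add_adjacent_intervals (hf _ hn)
      ((hf _ hn).symm.trans (hf _ hn')), ih]
    have hlast : ∫ t in (n * T)..(((n + 1 : ℕ) : ℝ) * T), f t = ∫ t in (0 : ℝ)..T, f t := by
      have h := intervalIntegral.integral_comp_add_right (a := 0) (b := T) f (n * T)
      rw [zero_add, show T + n * T = ((n + 1 : ℕ) : ℝ) * T by push_cast; ring] at h
      rw [← h]
      refine intervalIntegral.integral_congr fun t ht => hshift n t ?_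
      rw [uIcc_of_le hT] at ht
      exact ht.1
    rw [hlast]
    push_cast
    ring

end Integral

namespace QueueNetwork

variable {ι : Type*} [Fintype ι] [DecidableEq ι] {N : QueueNetwork ι}

/-- Over `n` periods every integral is `n * T` times its average, so the condition on averages is
scaled by `n * T`. -/
theorem IsPeriodic.longRunStable {T : ℝ} (hper : N.IsPeriodic T) (hT : 0 < T)
    (h : N.Stable T) : N.LongRunStable T := by
  obtain ⟨ε, hε, hst⟩ := h
  refine ⟨ε, hε, fun n hn i => ?_⟩
  have hc := integral_mul_period hT.le (N.c_integrable i) (fun t ht => (hper i t ht).2) n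
  have he : (fun j => ∫ t in (0 : ℝ)..(n * T), N.e j t) = (n * T) • average T N.e := by
    funext j
    rw [integral_mul_period hT.le (N.e_integrable j) (fun t ht => (hper j t ht).1) n]
    simp only [average, Pi.smul_apply, smul_eq_mul]
    field_simp
  have hc' : ∫ t in (0 : ℝ)..T, N.c i t = T * average T N.c i := by
    simp only [average]
    field_simp
  rw [he, hc, hc', Matrix.mulVec_smul, Pi.smul_apply, smul_eq_mul]
  have hn' : (0 : ℝ) < n := by exact_mod_cast hn
  have := mul_lt_mul_of_pos_left (hst i) (mul_pos hn' hT)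
  linarith

/-- The cumulative departures are bounded through the traffic equations: in a conserving network
nothing leaves a queue that was not there at the start, did not arrive from outside, and did not
arrive from another queue. -/
theorem cumulative_departure_le {φ : ι → ℝ → ℝ}
    (hint : ∀ i s t, -N.maxDelay ≤ s → -N.maxDelay ≤ t → IntervalIntegrable (φ i) volume s t)
    (hφ : ∀ i, ∀ᵐ t : ℝ, -N.maxDelay ≤ t → 0 ≤ φ i t) {t : ℝ} (ht : 0 ≤ t) {u : ι → ℝ}
    (hu : ∀ i, 0 ≤ u i + ∑ j, N.r j i * (∫ s in (-N.τ j i)..(t - N.τ j i), φ j s)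
      - ∫ s in (0 : ℝ)..t, φ i s) (i : ι) :
    ∫ s in (-N.maxDelay)..t, φ i s ≤
      ((1 - N.rᵀ)⁻¹ *ᵥ fun j => u j + ∫ s in (-N.maxDelay)..0, φ j s) i := by
  have hm := N.maxDelay_nonneg
  refine N.le_inv_one_sub_transpose_mulVec (v := fun i => ∫ s in (-N.maxDelay)..t, φ i s)
    (fun i => ?_) i
  have hsplit := intervalIntegral.integral_add_adjacent_intervals
    (hint i (-N.maxDelay) 0 le_rfl (by linarith)) (hint i 0 t (by linarith) (by linarith))
  -- As `φ ≥ 0`, each delayed window may be enlarged to `[-maxDelay, t]`, so the same vector `v`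
  -- stands on both sides.
  have hsum : ∑ j, N.r j i * (∫ s in (-N.τ j i)..(t - N.τ j i), φ j s) ≤
      ∑ j, N.r j i * ∫ s in (-N.maxDelay)..t, φ j s := by
    refine Finset.sum_le_sum fun j _ => mul_le_mul_of_nonneg_left ?_ (N.r_nonneg j i)
    have hτ := N.τ_le_maxDelay j i
    have hτ₀ := N.τ_pos j i
    have h₁ := intervalIntegral.integral_add_adjacent_intervals
      (hint j (-N.maxDelay) (-N.τ j i) le_rfl (by linarith))
      (hint j (-N.τ j i) (t - N.τ j i) (by linarith) (by linarith))
    have h₂ := intervalIntegral.integral_add_adjacent_intervals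
      (hint j (-N.maxDelay) (t - N.τ j i) le_rfl (by linarith))
      (hint j (t - N.τ j i) t (by linarith) (by linarith))
    have h₃ := intervalIntegral_nonneg_of_ae_of_le (hφ j) le_rfl
      (show -N.maxDelay ≤ -N.τ j i by linarith)
    have h₄ := intervalIntegral_nonneg_of_ae_of_le (hφ j)
      (show -N.maxDelay ≤ t - N.τ j i by linarith) (show t - N.τ j i ≤ t by linarith)
    linarith
  have := hu i
  linarith

/-- Under the stability condition no queue stays positive forever. -/
theorem LongRunStable.not_eventually_pos {T : ℝ} (hT : 0 < T) (hst : N.LongRunStable T)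
    {x b : ι → ℝ → ℝ} (h : N.IsSolution x b) (hx : ∀ i t, 0 ≤ t → 0 ≤ x i t)
    (hb : ∀ i, ∀ᵐ t : ℝ, -N.maxDelay ≤ t → 0 ≤ b i t) (i : ι) :
    ¬ ∀ᶠ t in atTop, 0 < x i t := by
  intro hpos
  have hm := N.maxDelay_nonneg
  obtain ⟨ε, hε, hst⟩ := hst
  obtain ⟨t₀, ht₀, hpos⟩ := ((atTop_basis' 0).eventually_iff).1 hpos
  set K : ι → ℝ := fun j => x j 0 + ∫ s in (-N.maxDelay)..0, b j s
  -- Full service after `t₀` and the traffic bound, set against stability, give `ε * n * T < M`. The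
  -- `n` chosen next contradicts this; it also ensures `t₀ ≤ n * T` and `1 ≤ n`.
  set M : ℝ := ((1 - N.rᵀ)⁻¹ *ᵥ K) i + ∫ s in (0 : ℝ)..t₀, N.c i s
  obtain ⟨n, hn⟩ := exists_nat_ge (max (max (M / (ε * T)) (t₀ / T)) 1)
  simp only [max_le_iff] at hn
  obtain ⟨⟨hnM, hnt⟩, hn1⟩ := hn
  rw [div_le_iff₀ (by positivity)] at hnM
  rw [div_le_iff₀ hT] at hnt
  have hnT : (0 : ℝ) ≤ n * T := by positivity
  have hupper := cumulative_departure_le (fun i s t => h.intervalIntegrable i) hb hnT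
    (u := fun j => x j 0 + ∫ s in (0 : ℝ)..(n * T), N.e j s)
    (fun j => by
      have h₁ := h.queue_eq j hnT
      have h₂ := hx j _ hnT
      linarith) i
  have hvec : (fun j => (x j 0 + ∫ s in (0 : ℝ)..(n * T), N.e j s)
      + ∫ s in (-N.maxDelay)..0, b j s) = K + fun j => ∫ s in (0 : ℝ)..(n * T), N.e j s := by
    funext j
    simp only [K, Pi.add_apply]
    ring
  rw [hvec, Matrix.mulVec_add, Pi.add_apply] at hupper
  have hlower : ∫ s in t₀..(n * T), N.c i s ≤ ∫ s in (-N.maxDelay)..(n * T), b i s := by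
    have hsplit := intervalIntegral.integral_add_adjacent_intervals
      (h.intervalIntegrable i (s := -N.maxDelay) (t := t₀) le_rfl (by linarith))
      (h.intervalIntegrable i (s := t₀) (t := n * T) (by linarith) (by linarith))
    have hnonneg := intervalIntegral_nonneg_of_ae_of_le (hb i) le_rfl
      (show -N.maxDelay ≤ t₀ by linarith)
    have heq : ∫ s in t₀..(n * T), b i s = ∫ s in t₀..(n * T), N.c i s := by
      refine intervalIntegral.integral_congr_ae ?_
      filter_upwards [h.service i] with s hs hsI
      rw [uIoc_of_le hnt] at hsI
      exact (hs (ht₀.trans hsI.1.le)).1 (hpos hsI.1.le)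
    linarith
  have hc := intervalIntegral.integral_add_adjacent_intervals (N.c_integrable i t₀ ht₀)
    ((N.c_integrable i t₀ ht₀).symm.trans (N.c_integrable i _ hnT))
  have hst := hst n (by exact_mod_cast hn1) i
  have hM : M = ((1 - N.rᵀ)⁻¹ *ᵥ K) i + ∫ s in (0 : ℝ)..t₀, N.c i s := rfl
  have : ε * n * T = n * (ε * T) := by ring
  linarith

end QueueNetwork

theorem exists_tendsto_atTop_of_monotoneOn {F : ℝ → ℝ} {a C : ℝ} (hF : MonotoneOn F (Ici a))
    (hC : ∀ t, a ≤ t → F t ≤ C) : ∃ L, Tendsto F atTop (𝓝 L) := by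
  have hmono : Monotone fun t => F (max t a) := fun s t hst =>
    hF (mem_Ici.2 (le_max_right _ _)) (mem_Ici.2 (le_max_right _ _)) (max_le_max_right a hst)
  refine ⟨_, (tendsto_atTop_ciSup hmono ⟨C, ?_⟩).congr' ?_⟩
  · rintro _ ⟨t, rfl⟩
    exact hC _ (le_max_right _ _)
  · filter_upwards [eventually_ge_atTop a] with t ht
    rw [max_eq_left ht]

/-! ### Convergence of the two trajectories -/

namespace QueueNetwork

variable {ι : Type*} [Fintype ι] [DecidableEq ι] {N : QueueNetwork ι} {x b z b' : ι → ℝ → ℝ}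

/-- The difference of two solutions satisfies the balance equation without external arrivals. -/
theorem sub_queue_eq_cumulative (hx : N.IsSolution x b) (hz : N.IsSolution z b') (i : ι) {t : ℝ}
    (ht : 0 ≤ t) : x i t - z i t = (x i 0 - z i 0)
      + ∑ j, N.r j i * (∫ s in (-N.τ j i)..(t - N.τ j i), (b j s - b' j s))
      - ∫ s in (0 : ℝ)..t, (b i s - b' i s) := by
  have hm := N.maxDelay_nonneg
  have hsub : ∀ j, ∫ s in (-N.τ j i)..(t - N.τ j i), (b j s - b' j s) =
      (∫ s in (-N.τ j i)..(t - N.τ j i), b j s) -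
        ∫ s in (-N.τ j i)..(t - N.τ j i), b' j s := fun j => by
    have hτ := N.τ_le_maxDelay j i
    exact intervalIntegral.integral_sub
      (hx.intervalIntegrable j (by linarith) (by linarith))
      (hz.intervalIntegrable j (by linarith) (by linarith))
  simp only [hsub, mul_sub, Finset.sum_sub_distrib]
  rw [intervalIntegral.integral_sub (hx.intervalIntegrable i (by linarith) (by linarith))
    (hz.intervalIntegrable i (by linarith) (by linarith)), hx.queue_eq i ht, hz.queue_eq i ht]
  ring

theorem exists_tendsto_cumulative_sub (hx : N.IsSolution x b) (hz : N.IsSolution z b')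
    (hb : ∀ i, ∀ᵐ t : ℝ, -N.maxDelay ≤ t → b' i t ≤ b i t)
    (hq : ∀ i t, 0 ≤ t → z i t ≤ x i t) (i : ι) :
    ∃ L, Tendsto (fun t => ∫ s in (-N.maxDelay)..t, (b i s - b' i s)) atTop (𝓝 L) := by
  have hm := N.maxDelay_nonneg
  have hint : ∀ i s t, -N.maxDelay ≤ s → -N.maxDelay ≤ t →
      IntervalIntegrable (fun u => b i u - b' i u) volume s t := fun i s t hs ht =>
    (hx.intervalIntegrable i hs ht).sub (hz.intervalIntegrable i hs ht)
  have hφ : ∀ i, ∀ᵐ t : ℝ, -N.maxDelay ≤ t → 0 ≤ b i t - b' i t := fun i => by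
    filter_upwards [hb i] with t ht h using sub_nonneg.2 (ht h)
  refine exists_tendsto_atTop_of_monotoneOn (a := 0) (fun s hs t ht hst => ?_) fun t ht =>
    cumulative_departure_le (φ := fun i u => b i u - b' i u) hint hφ ht
      (u := fun i => x i 0 - z i 0) (fun i => ?_) i
  · rw [mem_Ici] at hs ht
    have h₁ := intervalIntegral.integral_add_adjacent_intervals
      (hint i (-N.maxDelay) s le_rfl (by linarith)) (hint i s t (by linarith) (by linarith))
    have h₂ := intervalIntegral_nonneg_of_ae_of_le (hφ i) (show -N.maxDelay ≤ s by linarith) hst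
    linarith
  · rw [← sub_queue_eq_cumulative hx hz i ht]
    exact sub_nonneg.2 (hq i t ht)

/-- Conservation writes `x i - z i` as a finite combination of delayed cumulative surpluses, each of
which converges. -/
theorem exists_tendsto_sub_queue (hx : N.IsSolution x b) (hz : N.IsSolution z b')
    (hb : ∀ i, ∀ᵐ t : ℝ, -N.maxDelay ≤ t → b' i t ≤ b i t)
    (hq : ∀ i t, 0 ≤ t → z i t ≤ x i t) (i : ι) :
    ∃ L, Tendsto (fun t => x i t - z i t) atTop (𝓝 L) := by
  have hm := N.maxDelay_nonneg
  choose L hL using exists_tendsto_cumulative_sub hx hz hb hq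
  have hint : ∀ i s t, -N.maxDelay ≤ s → -N.maxDelay ≤ t →
      IntervalIntegrable (fun u => b i u - b' i u) volume s t := fun i s t hs ht =>
    (hx.intervalIntegrable i hs ht).sub (hz.intervalIntegrable i hs ht)
  set F : ι → ℝ → ℝ := fun i t => ∫ s in (-N.maxDelay)..t, (b i s - b' i s)
  have hF : ∀ i s t, -N.maxDelay ≤ s → -N.maxDelay ≤ t →
      ∫ u in s..t, (b i u - b' i u) = F i t - F i s := fun i s t hs ht =>
    (intervalIntegral.integral_interval_sub_left (hint i _ t le_rfl ht)
      (hint i _ s le_rfl hs)).symm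
  refine ⟨(x i 0 - z i 0) + ∑ j, N.r j i * (L j - F j (-N.τ j i)) - (L i - F i 0),
    Tendsto.congr' (f₁ := fun t => (x i 0 - z i 0)
      + ∑ j, N.r j i * (F j (t - N.τ j i) - F j (-N.τ j i)) - (F i t - F i 0)) ?_ ?_⟩
  · filter_upwards [eventually_ge_atTop 0] with t ht
    rw [sub_queue_eq_cumulative hx hz i ht, hF i 0 t (by linarith) (by linarith)]
    congr 2
    refine Finset.sum_congr rfl fun j _ => ?_
    have hτ := N.τ_le_maxDelay j i
    rw [hF j _ _ (by linarith) (by linarith)]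
  · refine (tendsto_const_nhds.add (tendsto_finsetSum _ fun j _ => ?_)).sub
      ((hL i).sub_const _)
    exact (((hL j).comp (tendsto_atTop_add_const_right _ _ tendsto_id)).sub_const _).const_mul _

theorem tendsto_sub_queue_zero {T : ℝ} (hT : 0 < T) (hst : N.LongRunStable T)
    (hx : N.IsSolution x b) (hz : N.IsSolution z b') (hz₀ : ∀ i t, 0 ≤ t → 0 ≤ z i t)
    (hb₀ : ∀ i, ∀ᵐ t : ℝ, -N.maxDelay ≤ t → 0 ≤ b i t)
    (hb : ∀ i, ∀ᵐ t : ℝ, -N.maxDelay ≤ t → b' i t ≤ b i t)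
    (hq : ∀ i t, 0 ≤ t → z i t ≤ x i t) (i : ι) :
    Tendsto (fun t => x i t - z i t) atTop (𝓝 0) := by
  obtain ⟨L, hL⟩ := exists_tendsto_sub_queue hx hz hb hq i
  have hL₀ : 0 ≤ L := ge_of_tendsto hL <| by
    filter_upwards [eventually_ge_atTop 0] with t ht using sub_nonneg.2 (hq i t ht)
  rcases hL₀.eq_or_lt with rfl | hLpos
  · exact hL
  · refine absurd ?_ (hst.not_eventually_pos hT hx
      (fun i t ht => (hz₀ i t ht).trans (hq i t ht)) hb₀ i)
    filter_upwards [hL.eventually_const_lt hLpos, eventually_ge_atTop 0] with t h ht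
    linarith [hz₀ i t ht]

/-- Since `b - b' ≥ 0`, every partial integral is at most the one over the whole window, a
difference of two values of a convergent function. -/
theorem tendsto_iSup_integral_sub_zero (hx : N.IsSolution x b) (hz : N.IsSolution z b')
    (hb : ∀ i, ∀ᵐ t : ℝ, -N.maxDelay ≤ t → b' i t ≤ b i t)
    (hq : ∀ i t, 0 ≤ t → z i t ≤ x i t) (i : ι) :
    Tendsto (fun t : ℝ => ⨆ s ∈ Icc (t - N.maxDelay) t,
      ENNReal.ofReal |∫ r in (t - N.maxDelay)..s, (b i r - b' i r)|) atTop (𝓝 0) := by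
  have hm := N.maxDelay_nonneg
  obtain ⟨L, hL⟩ := exists_tendsto_cumulative_sub hx hz hb hq i
  have hint : ∀ s t, -N.maxDelay ≤ s → -N.maxDelay ≤ t →
      IntervalIntegrable (fun u => b i u - b' i u) volume s t := fun s t hs ht =>
    (hx.intervalIntegrable i hs ht).sub (hz.intervalIntegrable i hs ht)
  have hφ : ∀ᵐ t : ℝ, -N.maxDelay ≤ t → 0 ≤ b i t - b' i t := by
    filter_upwards [hb i] with t ht h using sub_nonneg.2 (ht h)
  have hwindow := hL.sub (hL.comp (tendsto_atTop_add_const_right _ (-N.maxDelay) tendsto_id))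
  rw [sub_self] at hwindow
  have hwindow := ENNReal.tendsto_ofReal hwindow
  rw [ENNReal.ofReal_zero] at hwindow
  refine tendsto_of_tendsto_of_tendsto_of_le_of_le' tendsto_const_nhds hwindow
    (Eventually.of_forall fun t => zero_le) ?_
  filter_upwards [eventually_ge_atTop 0] with t ht
  refine iSup₂_le fun s hs => ENNReal.ofReal_le_ofReal ?_
  have h₁ := intervalIntegral_nonneg_of_ae_of_le hφ
    (show -N.maxDelay ≤ t - N.maxDelay by linarith) hs.1
  have h₂ := intervalIntegral_nonneg_of_ae_of_le hφ
    (show -N.maxDelay ≤ s by linarith [hs.1]) hs.2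
  have h₃ := intervalIntegral.integral_add_adjacent_intervals
    (hint (t - N.maxDelay) s (by linarith) (by linarith [hs.1]))
    (hint s t (by linarith [hs.1]) (by linarith))
  have h₄ := intervalIntegral.integral_add_adjacent_intervals
    (hint (-N.maxDelay) (t - N.maxDelay) le_rfl (by linarith))
    (hint (t - N.maxDelay) t (by linarith) (by linarith))
  rw [abs_of_nonneg h₁]
  simp only [Function.comp_apply, id, ← sub_eq_add_neg]
  linarith

theorem IsTrajectory.departure_nonneg {x₀ : ι → ℝ} {β₀ : ι → ℝ → ℝ}
    (h : N.IsTrajectory x₀ β₀ x b) (i : ι) : ∀ᵐ t : ℝ, -N.maxDelay ≤ t → 0 ≤ b i t := by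
  filter_upwards [h.solution.departure_nonneg i] with t ht hlow
  rcases le_total t 0 with hneg | hpos
  · rw [h.initial_history i t ⟨hlow, hneg⟩]
    exact h.β₀_nonneg i t ⟨hlow, hneg⟩
  · exact ht hpos

theorem IsTrajectory.queue_nonneg {x₀ : ι → ℝ} {β₀ : ι → ℝ → ℝ}
    (h : N.IsTrajectory x₀ β₀ x b) (i : ι) (t : ℝ) (ht : 0 ≤ t) : 0 ≤ x i t :=
  h.solution.queue_nonneg (fun i => (h.x₀_nonneg i).trans_eq (h.initial_queue i).symm)
    h.departure_nonneg i ht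

end QueueNetwork

theorem lemma2 {ι : Type*} [Fintype ι] [DecidableEq ι] (N : QueueNetwork ι)
    (T : ℝ) (hT : 0 < T)
    (hstable : (N.IsPeriodic T ∧ N.Stable T) ∨ N.LongRunStable T)
    (x₀ : ι → ℝ) (β₀ : ι → ℝ → ℝ) (x b z b' : ι → ℝ → ℝ)
    (hx : N.IsTrajectory x₀ β₀ x b)
    (hz : N.IsTrajectory (fun _ => 0) (fun _ _ => 0) z b') :
    (∀ i, Tendsto (fun t : ℝ => |x i t - z i t|) atTop (𝓝 0)) ∧
    (∀ i, Tendsto (fun t : ℝ => ⨆ s ∈ Icc (t - N.maxDelay) t,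
      ENNReal.ofReal |∫ r in (t - N.maxDelay)..s, (b i r - b' i r)|) atTop (𝓝 0)) := by
  have hst : N.LongRunStable T := hstable.elim (fun h => h.1.longRunStable hT h.2) id
  have h₀ : ∀ i, z i 0 ≤ x i 0 := fun i => by
    rw [hz.initial_queue i]
    exact hx.queue_nonneg i 0 le_rfl
  have hb := QueueNetwork.departure_mono hx.solution hz.solution hx.queue_nonneg
    hz.queue_nonneg h₀ fun i => by
      filter_upwards [hx.departure_nonneg i] with t ht htI
      rw [hz.initial_history i t htI]
      exact ht htI.1
  have hq : ∀ i t, 0 ≤ t → z i t ≤ x i t := fun i t ht =>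
    QueueNetwork.queue_mono hx.solution hz.solution hx.queue_nonneg h₀ hb i ht
  refine ⟨fun i => ?_, fun i =>
    QueueNetwork.tendsto_iSup_integral_sub_zero hx.solution hz.solution hb hq i⟩
  simpa using (QueueNetwork.tendsto_sub_queue_zero hT hst hx.solution hz.solution
    hz.queue_nonneg hx.departure_nonneg hb hq i).abs
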